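/- Let $N\ge 1$, $1\le p_1<p_2\le\infty$, $1\le s<\infty$ and $\lambda\in\mathbb{R}$ satisfy $$\frac1{p_2}<1-\frac{2\lambda}{N}<\frac1{p_1}\qquad\text{and}\qquad s>\frac{N}{2\lambda}$$ (the first condition forces $0<\lambda<N/2$; here $1/\infty=0$). Write $1/p_i'=1-1/p_i$. Let $$(I_{N-2\lambda}f)(x)=\int_{\mathbb{R}^N}\frac{f(y)}{|x-y|^{2\lambda}}\,dy,$$ $$([u,I_{N-2\lambda}]\rho)(t,x)=u(t,x)\,(I_{N-2\lambda}\rho(t,\cdot))(x)-(I_{N-2\lambda}(\rho u)(t,\cdot))(x)=\int_{\mathbb{R}^N}\frac{u(t,x)-u(t,y)}{|x-y|^{2\lambda}}\,\rho(t,y)\,dy .$$ For $q,p\in[1,\infty]$ and $T\in(0,\infty]$, $L^q(0,T;L^p(\mathbb{R}^N))$ denotes the measurable functions $f(t,x)$ on $(0,T)\times\mathbb{R}^N$ whose norm, the $L^q(0,T)$ norm of $t\mapsto\|f(t,\cdot)\|_{L^p(\mathbb{R}^N)}$, is finite. Then there is a constant $C=C(p_1,p_2,s,\lambda,N)>0$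 such that for every $T\in(0,\infty]$, every $m\ge 0$, every real-valued $\rho\in L^\infty(0,T;L^{p_1}(\mathbb{R}^N))\cap L^\infty(0,T;L^{p_2}(\mathbb{R}^N))$ and every $u\in L^1(0,T;L^s(\mathbb{R}^N;\mathbb{R}^m))$, the integrals defining $I_{N-2\lambda}\rho(t,\cdot)$ and $I_{N-2\lambda}(\rho u)(t,\cdot)$ at $x$ converge absolutely for almost every $(t,x)\in(0,T)\times\mathbb{R}^N$, the commutator $[u,I_{N-2\lambda}]\rho$ belongs to $L^1(0,T;L^s(\mathbb{R}^N;\mathbb{R}^m))$, and $$\|[u,I_{N-2\lambda}]\rho\|_{L^1(0,T;L^s)}\le C\,\|u\|_{L^1(0,T;L^s)}\,\|\rho\|_{L^\infty(0,T;L^{p_1})}^{\left(\frac1{p_2'}-\frac{2\lambda}{N}\right)/\left(\frac1{p_1}-\frac1{p_2}\right)}\,\|\rho\|_{L^\infty(0,T;L^{p_2})}^{\left(\frac{2\lambda}{N}-\frac1{p_1'}\right)/\left(\frac1{p_1}-\frac1{p_2}\right)}.$$ -/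

import Mathlib

open MeasureTheory
open scoped ENNReal

noncomputable section

/-- Lebesgue measure on the time interval `(0, T)`, where `0 < T ≤ +∞`. -/
def timeMeasure (T : EReal) : Measure ℝ :=
  volume.restrict {t : ℝ | 0 < t ∧ (t : EReal) < T}

/-- The norm of `L^q(0,T; L^p(ℝ^N; E))`: the `L^q(0,T)` norm of `t ↦ ‖f(t,·)‖_{L^p(ℝ^N)}`,
as an extended nonnegative number. -/
def mixedNorm {N : ℕ} {E : Type*} [NormedAddCommGroup E] (T : EReal) (q p : ℝ≥0∞)
    (f : ℝ → EuclideanSpace ℝ (Fin N) → E) : ℝ≥0∞ :=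
  eLpNorm (fun t => eLpNorm (f t) p volume) q (timeMeasure T)

/-- Membership in `L^q(0,T; L^p(ℝ^N; E))`, for functions `f(t,x)` that are Lebesgue measurable in
`(t,x) ∈ (0,T) × ℝ^N`: the mixed norm is finite. (Every Bochner measurable map from `(0,T)` to
`L^p` has such a representative; for `p = ∞` this is the larger, usual class which only asks
for joint measurability.) -/
def MemMixed {N : ℕ} {E : Type*} [NormedAddCommGroup E] (T : EReal) (q p : ℝ≥0∞)
    (f : ℝ → EuclideanSpace ℝ (Fin N) → E) : Prop :=
  AEStronglyMeasurable (Function.uncurry f) ((timeMeasure T).prod volume) ∧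
    mixedNorm T q p f < ∞

/-- The integrand `y ↦ f(y) / |x - y|^(N - α)` of the Riesz potential of order `α` at `x`. -/
def rieszIntegrand {N : ℕ} {E : Type*} [NormedAddCommGroup E] [NormedSpace ℝ E] (α : ℝ)
    (f : EuclideanSpace ℝ (Fin N) → E) (x y : EuclideanSpace ℝ (Fin N)) : E :=
  (1 / ‖x - y‖ ^ ((N : ℝ) - α)) • f y

/-- The Riesz potential `(I_α f)(x) = ∫ f(y) / |x - y|^(N - α) dy` (without normalizing
constant), for scalar or vector-valued `f`. -/
def rieszPotential {N : ℕ} {E : Type*} [NormedAddCommGroup E] [NormedSpace ℝ E] (α : ℝ)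
    (f : EuclideanSpace ℝ (Fin N) → E) (x : EuclideanSpace ℝ (Fin N)) : E :=
  ∫ y, rieszIntegrand α f x y

/-- The commutator `[M_u, I_α] ρ = u · (I_α ρ) - I_α (ρ u)`, with `M_u` multiplication by `u`. -/
def rieszCommutator {N : ℕ} {E : Type*} [NormedAddCommGroup E] [NormedSpace ℝ E] (α : ℝ)
    (u : EuclideanSpace ℝ (Fin N) → E) (ρ : EuclideanSpace ℝ (Fin N) → ℝ)
    (x : EuclideanSpace ℝ (Fin N)) : E :=
  rieszPotential α ρ x • u x - rieszPotential α (fun y => ρ y • u y) x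

/-- Where both integrals converge absolutely, the commutator is
`∫ ((u(x) - u(y)) / |x - y|^(N - α)) ρ(y) dy`. -/
theorem rieszCommutator_eq_integral {N : ℕ} {E : Type*} [NormedAddCommGroup E] [NormedSpace ℝ E]
    [CompleteSpace E] (α : ℝ) (u : EuclideanSpace ℝ (Fin N) → E)
    (ρ : EuclideanSpace ℝ (Fin N) → ℝ) (x : EuclideanSpace ℝ (Fin N))
    (h₁ : Integrable (rieszIntegrand α ρ x))
    (h₂ : Integrable (rieszIntegrand α (fun y => ρ y • u y) x)) :
    rieszCommutator α u ρ x =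
      ∫ y, (ρ y / ‖x - y‖ ^ ((N : ℝ) - α)) • (u x - u y) := by
  unfold rieszCommutator rieszPotential
  rw [← integral_smul_const, ← integral_sub (h₁.smul_const (u x)) h₂]
  refine integral_congr_ae (Filter.Eventually.of_forall fun y => ?_)
  simp only [rieszIntegrand, smul_sub, smul_smul, smul_eq_mul]
  rw [one_div_mul_eq_div]

end

/-!
Write `a = 2λ` and `w = 1 - a / N`, so that `1 / p₂ < w < 1 / p₁` and `1 / s + w < 1`. The two terms
of the commutator are estimated separately; no cancellation between them is used.

Both terms follow from bounds on the kernel `|z|⁻ᵃ`. Pick `w₂ < w < w₁` strictly between `1 / p₂`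
and `1 / p₁`, with `w₁ + 1 / s < 1` as well, and cut the kernel at a radius `R`. The part near `0`
has finite norm in the space dual to `L^(1/w₂)`, the part away from `0` in the space dual to
`L^(1/w₁)`; by scaling these norms are constant multiples of `R ^ (N (w - w₂))` and
`R ^ (N (w - w₁))` (`lintegral_truncatedKernel_rpow`).

* For `u · I ρ`, Hölder's inequality bounds `I ρ` uniformly (`lintegral_kernel_mul_le`).
* For `I (ρ u)`, a Young type inequality gives `‖K ∗ (f g)‖_s ≤ ‖K‖_{q'} ‖f‖_q ‖g‖_s` as soon as
  `1 / s + 1 / q ≤ 1` (`lintegral_kernel_mul_mul_rpow_le`). Choosing exponents off the critical one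
  is what makes this elementary inequality suffice in place of the Hardy–Littlewood–Sobolev
  inequality.

The norms of `ρ` in `L^(1/w₁)` and `L^(1/w₂)` are interpolated between `L^p₁` and `L^p₂`
(`lintegral_enorm_rpow_interpolate`), and `R` is chosen to balance the near and far parts
(`balancing_radius_rpow`); the result, `exists_rieszKernel_bound`, is independent of `w₁` and `w₂`
up to the constant. The estimate in space is applied with the essential suprema in time of
`‖ρ(t)‖_{p₁}` and `‖ρ(t)‖_{p₂}`, hence with one radius for almost all times, and integrated in `t`.
-/

/-! ### Hölder, Young and interpolation inequalities -/

theorem lintegral_rpow_mul_rpow_mul_rpow_le {α : Type*} [MeasurableSpace α] {μ : Measure α}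
    {f g h : α → ℝ≥0∞} (hf : AEMeasurable f μ) (hg : AEMeasurable g μ) (hh : AEMeasurable h μ)
    {a b c : ℝ} (ha : 0 ≤ a) (hb : 0 ≤ b) (hc : 0 ≤ c) (habc : a + b + c = 1) :
    ∫⁻ x, f x ^ a * g x ^ b * h x ^ c ∂μ ≤
      (∫⁻ x, f x ∂μ) ^ a * (∫⁻ x, g x ∂μ) ^ b * (∫⁻ x, h x ∂μ) ^ c := by
  have := ENNReal.lintegral_prod_norm_pow_le (μ := μ) (Finset.univ : Finset (Fin 3))
    (f := ![f, g, h]) (p := ![a, b, c])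
    (by intro i _; fin_cases i <;> simpa) (by simpa [Fin.sum_univ_three] using habc)
    (by intro i _; fin_cases i <;> simpa)
  simpa [Fin.prod_univ_three] using this

theorem lintegral_kernel_mul_le {G : Type*} [AddCommGroup G] [MeasurableSpace G]
    [MeasurableAdd₂ G] [MeasurableNeg G] {μ : Measure G} [μ.IsAddLeftInvariant]
    [μ.IsNegInvariant] {K f : G → ℝ≥0∞} (hK : Measurable K) (hf : AEMeasurable f μ)
    {q q' : ℝ} (hq : q.HolderConjugate q') (x : G) :
    ∫⁻ y, K (x - y) * f y ∂μ ≤ (∫⁻ z, K z ^ q' ∂μ) ^ (1 / q') * (∫⁻ y, f y ^ q ∂μ) ^ (1 / q) := by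
  have h := ENNReal.lintegral_mul_le_Lp_mul_Lq μ hq.symm (f := fun y => K (x - y))
    (hK.comp (measurable_id.const_sub x)).aemeasurable hf
  rwa [lintegral_sub_left_eq_self (fun z => K z ^ q') x] at h

/-- A Young type inequality `‖K ∗ (f g)‖_s ≤ ‖K‖_{q'} ‖f‖_q ‖g‖_s`. The integrand is factored as
`(K^q' g^s)^(1/s) · (f^q)^(1/q) · (K^q')^(1/q' - 1/s)`; after Hölder's inequality in `y` only the
first factor depends on `x`, and its `s`-th power is integrated by Tonelli's theorem. -/
theorem lintegral_kernel_mul_mul_rpow_le {G : Type*} [AddCommGroup G] [MeasurableSpace G]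
    [MeasurableAdd₂ G] [MeasurableNeg G] {μ : Measure G} [μ.IsAddLeftInvariant] [SFinite μ]
    [μ.IsNegInvariant] {K f g : G → ℝ≥0∞} (hK : Measurable K) (hf : AEMeasurable f μ)
    (hg : AEMeasurable g μ) {q q' s : ℝ} (hq : q.HolderConjugate q') (hs : 0 < s)
    (hqs : 1 / s + 1 / q ≤ 1) :
    (∫⁻ x, (∫⁻ y, K (x - y) * f y * g y ∂μ) ^ s ∂μ) ^ (1 / s) ≤
      (∫⁻ z, K z ^ q' ∂μ) ^ (1 / q') * (∫⁻ y, f y ^ q ∂μ) ^ (1 / q) *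
        (∫⁻ y, g y ^ s ∂μ) ^ (1 / s) := by
  have hq0 := hq.pos
  have hq'0 := hq.symm.pos
  have hsum : 1 / q + 1 / q' = 1 := by simpa using hq.inv_add_inv_eq_one
  set M := ∫⁻ z, K z ^ q' ∂μ
  set F := ∫⁻ y, f y ^ q ∂μ
  have hc : 0 ≤ 1 / q' - 1 / s := by linarith
  have hpt (x : G) : (∫⁻ y, K (x - y) * f y * g y ∂μ) ≤
      (∫⁻ y, K (x - y) ^ q' * g y ^ s ∂μ) ^ (1 / s) * F ^ (1 / q) * M ^ (1 / q' - 1 / s) := by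
    have hKx : Measurable fun y => K (x - y) ^ q' :=
      (hK.comp (measurable_id.const_sub x)).pow_const _
    have h := lintegral_rpow_mul_rpow_mul_rpow_le (μ := μ)
      (hKx.aemeasurable.mul (hg.pow_const s)) (hf.pow_const q) hKx.aemeasurable
      (a := 1 / s) (b := 1 / q) (c := 1 / q' - 1 / s) (by positivity) (by positivity) hc
      (by linarith)
    rw [lintegral_sub_left_eq_self (fun z => K z ^ q') x] at h
    refine le_trans (le_of_eq (lintegral_congr fun y => ?_)) h
    simp only [Pi.mul_apply]
    rw [ENNReal.mul_rpow_of_nonneg _ _ (by positivity), ← ENNReal.rpow_mul, ← ENNReal.rpow_mul,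
      ← ENNReal.rpow_mul, ← ENNReal.rpow_mul, mul_one_div_cancel hs.ne',
      mul_one_div_cancel hq0.ne', ENNReal.rpow_one, ENNReal.rpow_one]
    have : K (x - y) = K (x - y) ^ (q' * (1 / s)) * K (x - y) ^ (q' * (1 / q' - 1 / s)) := by
      rw [← ENNReal.rpow_add_of_nonneg _ _ (by positivity) (by positivity), ← mul_add,
        add_sub_cancel, mul_one_div_cancel hq'0.ne', ENNReal.rpow_one]
    conv_lhs => rw [this]
    ring
  have hmeas : AEMeasurable (Function.uncurry fun x y => K (x - y) ^ q' * g y ^ s) (μ.prod μ) := by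
    refine AEMeasurable.mul ?_ ?_
    · exact ((hK.comp (measurable_fst.sub measurable_snd)).pow_const _).aemeasurable
    · exact (hg.comp_quasiMeasurePreserving Measure.quasiMeasurePreserving_snd).pow_const _
  have htonelli : ∫⁻ x, ∫⁻ y, K (x - y) ^ q' * g y ^ s ∂μ ∂μ = M * ∫⁻ y, g y ^ s ∂μ := by
    rw [lintegral_lintegral_swap hmeas, ← lintegral_const_mul'' _ (hg.pow_const s)]
    refine lintegral_congr fun y => ?_
    have hKy : Measurable fun x => K (x - y) ^ q' :=
      (hK.comp (measurable_id.sub_const y)).pow_const _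
    rw [lintegral_mul_const _ hKy, lintegral_sub_right_eq_self (fun z => K z ^ q') y]
  have hinner : AEMeasurable (fun x => ∫⁻ y, K (x - y) ^ q' * g y ^ s ∂μ) μ :=
    hmeas.lintegral_prod_right'
  calc
    _ ≤ (∫⁻ x, (∫⁻ y, K (x - y) ^ q' * g y ^ s ∂μ) *
          (F ^ (1 / q) * M ^ (1 / q' - 1 / s)) ^ s ∂μ) ^ (1 / s) := by
      gcongr with x
      refine (ENNReal.rpow_le_rpow (hpt x) hs.le).trans_eq ?_
      rw [mul_assoc, ENNReal.mul_rpow_of_nonneg _ _ hs.le, ← ENNReal.rpow_mul,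
        one_div_mul_cancel hs.ne', ENNReal.rpow_one]
    _ = _ := by
      rw [lintegral_mul_const'' _ hinner, htonelli,
        ENNReal.mul_rpow_of_nonneg _ _ (by positivity : 0 ≤ 1 / s),
        ENNReal.mul_rpow_of_nonneg _ _ (by positivity : 0 ≤ 1 / s), ← ENNReal.rpow_mul,
        mul_one_div_cancel hs.ne', ENNReal.rpow_one]
      have : M ^ (1 / q') = M ^ (1 / s) * M ^ (1 / q' - 1 / s) := by
        rw [← ENNReal.rpow_add_of_nonneg _ _ (by positivity) hc, add_sub_cancel]
      rw [this]
      ring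

/-- The interpolation inequality `‖f‖_q ≤ ‖f‖_{p₁}^θ ‖f‖_{p₂}^(1-θ)`, where
`1/q = θ/p₁ + (1-θ)/p₂` and `p₂ = ∞` is allowed. -/
theorem lintegral_enorm_rpow_interpolate {α E : Type*} [MeasurableSpace α]
    [NormedAddCommGroup E] {μ : Measure α} {f : α → E} (hf : AEStronglyMeasurable f μ)
    {p₁ p₂ : ℝ≥0∞} (hp₁ : 1 ≤ p₁) (hp₁₂ : p₁ < p₂) {q : ℝ}
    (h₁ : 1 / q ≤ (p₁⁻¹).toReal) (h₂ : (p₂⁻¹).toReal < 1 / q) :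
    (∫⁻ x, ‖f x‖ₑ ^ q ∂μ) ^ (1 / q) ≤
      eLpNorm f p₁ μ ^ ((1 / q - (p₂⁻¹).toReal) / ((p₁⁻¹).toReal - (p₂⁻¹).toReal)) *
      eLpNorm f p₂ μ ^ (((p₁⁻¹).toReal - 1 / q) / ((p₁⁻¹).toReal - (p₂⁻¹).toReal)) := by
  have hq : 0 < q := one_div_pos.1 (ENNReal.toReal_nonneg.trans_lt h₂)
  have hp₁0 : p₁ ≠ 0 := (zero_lt_one.trans_le hp₁).ne'
  have hp₁t : p₁ ≠ ∞ := hp₁₂.ne_top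
  have hp : 0 < p₁.toReal := ENNReal.toReal_pos hp₁0 hp₁t
  have hD : 0 < (p₁⁻¹).toReal - (p₂⁻¹).toReal := by linarith
  set D := (p₁⁻¹).toReal - (p₂⁻¹).toReal with hDdef
  have hf' : AEMeasurable (fun x => ‖f x‖ₑ) μ := hf.enorm
  rw [eLpNorm_eq_lintegral_rpow_enorm_toReal hp₁0 hp₁t, ← ENNReal.rpow_mul]
  by_cases hp₂t : p₂ = ∞
  · subst hp₂t
    simp only [ENNReal.inv_top, ENNReal.toReal_zero, sub_zero, ENNReal.toReal_inv] at *
    have hθ : 1 / p₁.toReal * (1 / q / D) = 1 / q := by rw [hDdef]; field_simp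
    have hpq : p₁.toReal ≤ q := by
      rw [one_div] at h₁
      exact (inv_le_inv₀ hq hp).1 h₁
    have hη : (p₁.toReal⁻¹ - 1 / q) / D = (q - p₁.toReal) * (1 / q) := by
      rw [hDdef]; field_simp
    rw [hθ, hη, ENNReal.rpow_mul, ← ENNReal.mul_rpow_of_nonneg _ _ (by positivity)]
    gcongr
    rw [← lintegral_mul_const'' _ (hf'.pow_const _)]
    refine lintegral_mono_ae ?_
    filter_upwards [ae_le_eLpNormEssSup (f := f) (μ := μ)] with x hx
    calc ‖f x‖ₑ ^ q = ‖f x‖ₑ ^ p₁.toReal * ‖f x‖ₑ ^ (q - p₁.toReal) := by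
          rw [← ENNReal.rpow_add_of_nonneg _ _ hp.le (by linarith), add_sub_cancel]
      _ ≤ _ := by
          rw [eLpNorm_exponent_top]
          gcongr
  · have hp₂0 : p₂ ≠ 0 := (zero_le.trans_lt hp₁₂).ne'
    have hp₂ : 0 < p₂.toReal := ENNReal.toReal_pos hp₂0 hp₂t
    rw [eLpNorm_eq_lintegral_rpow_enorm_toReal hp₂0 hp₂t, ← ENNReal.rpow_mul]
    simp only [ENNReal.toReal_inv] at *
    set θ := (1 / q - p₂.toReal⁻¹) / D with hθ
    set η := (p₁.toReal⁻¹ - 1 / q) / D with hη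
    have hθ0 : 0 ≤ θ := div_nonneg (by linarith) hD.le
    have hη0 : 0 ≤ η := div_nonneg (by linarith) hD.le
    have hsum : θ * p₁.toReal⁻¹ + η * p₂.toReal⁻¹ = 1 / q := by
      have : θ * p₁.toReal⁻¹ + η * p₂.toReal⁻¹ = (1 / q * D) / D := by
        rw [hθ, hη, hDdef]; ring
      rw [this, mul_div_cancel_right₀ _ hD.ne']
    have hθη : θ + η = 1 := by
      rw [hθ, hη, ← add_div, div_eq_one_iff_eq hD.ne', hDdef]; ring
    have hw : q * (θ * p₁.toReal⁻¹) + q * (η * p₂.toReal⁻¹) = 1 := by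
      rw [← mul_add, hsum, mul_one_div_cancel hq.ne']
    have h := ENNReal.lintegral_mul_norm_pow_le (hf'.pow_const p₁.toReal)
      (hf'.pow_const p₂.toReal) (by positivity) (by positivity) hw
    have h' := ENNReal.rpow_le_rpow h (by positivity : 0 ≤ 1 / q)
    rw [ENNReal.mul_rpow_of_nonneg _ _ (by positivity : 0 ≤ 1 / q), ← ENNReal.rpow_mul,
      ← ENNReal.rpow_mul] at h'
    convert h' using 2
    · refine lintegral_congr fun x => ?_
      rw [← ENNReal.rpow_mul, ← ENNReal.rpow_mul,
        ← ENNReal.rpow_add_of_nonneg _ _ (by positivity) (by positivity)]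
      congr 1
      field_simp
      linarith
    · congr 1; field_simp
    · congr 1; field_simp

/-! ### Integrals of powers of the norm -/

section PowerIntegrals
variable {E : Type*} [NormedAddCommGroup E] [NormedSpace ℝ E] [FiniteDimensional ℝ E]
  [MeasurableSpace E] [BorelSpace E] (μ : Measure E) [μ.IsAddHaarMeasure]

theorem lintegral_ball_norm_rpow_lt_top [Nontrivial E] {b : ℝ}
    (hb : b < Module.finrank ℝ E) :
    ∫⁻ x in Metric.ball (0 : E) 1, ENNReal.ofReal (‖x‖ ^ (-b)) ∂μ < ∞ := by
  have hn : 0 < Module.finrank ℝ E := Module.finrank_pos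
  have : IntegrableOn (fun x : E => ‖x‖ ^ (-b)) (Metric.ball 0 1) μ := by
    rw [integrableOn_fun_norm_addHaar μ (f := fun t => t ^ (-b))]
    have h : IntegrableOn (fun t : ℝ => t ^ ((Module.finrank ℝ E : ℝ) - 1 - b)) (Set.Ioo 0 1) := by
      refine (intervalIntegral.integrableOn_Ioo_rpow_iff zero_lt_one).2 (by linarith)
    refine h.congr_fun (fun t ht => ?_) measurableSet_Ioo
    simp only [smul_eq_mul]
    rw [← Real.rpow_natCast, ← Real.rpow_add ht.1, Nat.cast_sub hn]
    simp [sub_eq_add_neg]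
  exact (hasFiniteIntegral_iff_ofReal (ae_of_all _ fun x => by positivity)).1 this.2

theorem lintegral_compl_ball_norm_rpow_lt_top [Nontrivial E] {b : ℝ}
    (hb : Module.finrank ℝ E < b) :
    ∫⁻ x in (Metric.ball (0 : E) 1)ᶜ, ENNReal.ofReal (‖x‖ ^ (-b)) ∂μ < ∞ := by
  have hn : 0 < Module.finrank ℝ E := Module.finrank_pos
  have : IntegrableOn (fun x : E => ‖x‖ ^ (-b)) (Metric.ball 0 1)ᶜ μ := by
    rw [← integrable_indicator_iff Metric.isOpen_ball.measurableSet.compl]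
    have e : (Metric.ball (0 : E) 1)ᶜ.indicator (fun x : E => ‖x‖ ^ (-b)) =
        fun x => (Set.Ici (1 : ℝ)).indicator (fun t => t ^ (-b)) ‖x‖ := by
      ext x; simp [Set.indicator]
    rw [e, integrable_fun_norm_addHaar μ (f := (Set.Ici (1 : ℝ)).indicator fun t => t ^ (-b))]
    have e2 : (fun y : ℝ => y ^ (Module.finrank ℝ E - 1) •
        (Set.Ici (1 : ℝ)).indicator (fun t => t ^ (-b)) y) =
        (Set.Ici (1 : ℝ)).indicator
          (fun y => y ^ (Module.finrank ℝ E - 1) • y ^ (-b)) := by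
      ext y; simp [Set.indicator]
    rw [e2]
    refine IntegrableOn.integrable_indicator ?_ measurableSet_Ici |>.integrableOn
    rw [integrableOn_Ici_iff_integrableOn_Ioi]
    have h := integrableOn_Ioi_rpow_of_lt
      (a := (Module.finrank ℝ E : ℝ) - 1 - b) (by linarith) zero_lt_one
    refine h.congr_fun (fun t ht => ?_) measurableSet_Ioi
    have ht : (0 : ℝ) < t := zero_lt_one.trans ht
    simp only [smul_eq_mul]
    rw [← Real.rpow_natCast, ← Real.rpow_add ht, Nat.cast_sub hn]
    simp [sub_eq_add_neg]
  exact (hasFiniteIntegral_iff_ofReal (ae_of_all _ fun x => by positivity)).1 this.2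

/-- Homogeneity under the dilation `x ↦ R x`: the integral of `‖x‖^(-b)` over the set `‖x‖ / R ∈ S`
scales like `R ^ (n - b)`. -/
theorem lintegral_indicator_norm_rpow_scale {S : Set ℝ} (hS : MeasurableSet S) (b : ℝ) {R : ℝ}
    (hR : 0 < R) :
    ∫⁻ x, {x : E | ‖x‖ / R ∈ S}.indicator (fun x => ENNReal.ofReal (‖x‖ ^ (-b))) x ∂μ =
      ENNReal.ofReal (R ^ (Module.finrank ℝ E - b)) *
        ∫⁻ x in {x : E | ‖x‖ ∈ S}, ENNReal.ofReal (‖x‖ ^ (-b)) ∂μ := by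
  have hm : MeasurableSet {x : E | ‖x‖ / R ∈ S} := (measurable_norm.div_const R) hS
  have hm1 : MeasurableSet {x : E | ‖x‖ ∈ S} := measurable_norm hS
  have hk : Measurable fun x : E => ENNReal.ofReal (‖x‖ ^ (-b)) := by fun_prop
  have h := lintegral_map (μ := μ) (hk.indicator hm)
    (measurable_const_smul R : Measurable (R • · : E → E))
  rw [Measure.map_addHaar_smul μ hR.ne', lintegral_smul_measure] at h
  have e : ∀ x : E, {x : E | ‖x‖ / R ∈ S}.indicator (fun x => ENNReal.ofReal (‖x‖ ^ (-b))) (R • x)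
      = ENNReal.ofReal (R ^ (-b)) *
        {x : E | ‖x‖ ∈ S}.indicator (fun x => ENNReal.ofReal (‖x‖ ^ (-b))) x := by
    intro x
    have : ‖R • x‖ = R * ‖x‖ := by rw [norm_smul, Real.norm_of_nonneg hR.le]
    by_cases hx : ‖x‖ ∈ S
    · simp [Set.indicator, this, hx, mul_div_cancel_left₀ _ hR.ne',
        Real.mul_rpow hR.le (norm_nonneg x), ENNReal.ofReal_mul (Real.rpow_nonneg hR.le _)]
    · simp [Set.indicator, this, hx, mul_div_cancel_left₀ _ hR.ne']
  simp_rw [e] at h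
  rw [lintegral_const_mul _ (hk.indicator hm1), lintegral_indicator hm1, smul_eq_mul] at h
  have hRn : (0 : ℝ) < R ^ Module.finrank ℝ E := by positivity
  rw [abs_of_pos (inv_pos.2 hRn)] at h
  calc _ = ENNReal.ofReal (R ^ Module.finrank ℝ E) * (ENNReal.ofReal (R ^ Module.finrank ℝ E)⁻¹ *
        ∫⁻ x, {x : E | ‖x‖ / R ∈ S}.indicator (fun x => ENNReal.ofReal (‖x‖ ^ (-b))) x ∂μ) := by
        rw [← mul_assoc, ← ENNReal.ofReal_mul hRn.le, mul_inv_cancel₀ hRn.ne', ENNReal.ofReal_one,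
          one_mul]
    _ = _ := by
        rw [h, ← mul_assoc, ← ENNReal.ofReal_mul hRn.le, sub_eq_add_neg, Real.rpow_add hR,
          Real.rpow_natCast]
end PowerIntegrals

/-! ### The truncated Riesz kernel -/

section Kernel
variable {E : Type*} [NormedAddCommGroup E]

/-- The kernel `‖z‖^(-a)` with values in `[0, ∞]`. Its value at `z = 0` is that of `Real.rpow`
(finite), which affects no integral. -/
noncomputable def rieszKernel (a : ℝ) (z : E) : ℝ≥0∞ := ENNReal.ofReal (‖z‖ ^ (-a))

/-- The kernel `‖z‖^(-a)` restricted to the `z` with `‖z‖ / R ∈ S`: for `S = Iio 1` the part inside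
the ball of radius `R`, for `S = Ici 1` the part outside. -/
noncomputable def truncatedKernel (a : ℝ) (S : Set ℝ) (R : ℝ) : E → ℝ≥0∞ :=
  {z : E | ‖z‖ / R ∈ S}.indicator (rieszKernel a)

theorem measurable_rieszKernel [MeasurableSpace E] [BorelSpace E] (a : ℝ) :
    Measurable (rieszKernel a : E → ℝ≥0∞) := by
  unfold rieszKernel
  fun_prop

theorem measurable_truncatedKernel [MeasurableSpace E] [BorelSpace E] (a : ℝ) {S : Set ℝ}
    (hS : MeasurableSet S) (R : ℝ) : Measurable (truncatedKernel a S R : E → ℝ≥0∞) :=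
  (measurable_rieszKernel a).indicator ((measurable_norm.div_const R) hS)

theorem rieszKernel_eq_add (a R : ℝ) (z : E) :
    rieszKernel a z = truncatedKernel a (Set.Iio 1) R z + truncatedKernel a (Set.Ici 1) R z := by
  by_cases h : ‖z‖ / R < 1
  · simp [truncatedKernel, Set.indicator, h, not_le.2 h]
  · simp [truncatedKernel, Set.indicator, h, not_lt.1 h]

theorem lintegral_truncatedKernel_rpow [NormedSpace ℝ E] [FiniteDimensional ℝ E]
    [MeasurableSpace E] [BorelSpace E] (μ : Measure E) [μ.IsAddHaarMeasure] (a : ℝ) {S : Set ℝ}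
    (hS : MeasurableSet S) {R q : ℝ} (hR : 0 < R) (hq : 0 < q) :
    (∫⁻ z : E, truncatedKernel a S R z ^ q ∂μ) ^ (1 / q) =
      ENNReal.ofReal (R ^ (Module.finrank ℝ E * (1 / q) - a)) *
        (∫⁻ z in {z : E | ‖z‖ ∈ S}, ENNReal.ofReal (‖z‖ ^ (-(a * q))) ∂μ) ^ (1 / q) := by
  have e : ∀ z : E, truncatedKernel a S R z ^ q = {z : E | ‖z‖ / R ∈ S}.indicator
      (fun z => ENNReal.ofReal (‖z‖ ^ (-(a * q)))) z := by
    intro z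
    by_cases h : ‖z‖ / R ∈ S
    · simp only [truncatedKernel, Set.indicator, Set.mem_ofPred_eq, h, if_true, rieszKernel]
      rw [ENNReal.ofReal_rpow_of_nonneg (by positivity) hq.le, ← Real.rpow_mul (norm_nonneg z),
        neg_mul]
    · simp [truncatedKernel, Set.indicator, h, hq]
  simp_rw [e]
  rw [lintegral_indicator_norm_rpow_scale μ hS _ hR, ENNReal.mul_rpow_of_nonneg _ _ (by positivity),
    ENNReal.ofReal_rpow_of_nonneg (by positivity) (by positivity), ← Real.rpow_mul hR.le]
  congr 4
  field_simp
end Kernel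

/-! ### Bounds in space -/

/-- For `R = (x / y)^(1 / (n (v₁ - v₂)))`, the product of `R^(n (w - w'))` with the interpolated
norm bound of exponent `1 / w'` does not depend on `w'`. -/
theorem balancing_radius_rpow {x y : ℝ} (hx : 0 < x) (hy : 0 < y) {n v₁ v₂ : ℝ} (hn : n ≠ 0)
    (hv : v₁ - v₂ ≠ 0) (w w' : ℝ) :
    ((x / y) ^ (1 / (n * (v₁ - v₂)))) ^ (n * (w - w')) *
        (x ^ ((w' - v₂) / (v₁ - v₂)) * y ^ ((v₁ - w') / (v₁ - v₂))) =
      x ^ ((w - v₂) / (v₁ - v₂)) * y ^ ((v₁ - w) / (v₁ - v₂)) := by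
  have hR : ((x / y) ^ (1 / (n * (v₁ - v₂)))) ^ (n * (w - w')) =
      x ^ ((w - w') / (v₁ - v₂)) * y ^ (-((w - w') / (v₁ - v₂))) := by
    rw [← Real.rpow_mul (by positivity), Real.div_rpow hx.le hy.le, Real.rpow_neg hy.le,
      div_eq_mul_inv]
    have : 1 / (n * (v₁ - v₂)) * (n * (w - w')) = (w - w') / (v₁ - v₂) := by field_simp
    rw [this]
  rw [hR, mul_mul_mul_comm, ← Real.rpow_add hx, ← Real.rpow_add hy]
  congr 2 <;> ring

theorem aemeasurable_lintegral_kernel_mul_mul {G : Type*} [AddCommGroup G] [MeasurableSpace G]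
    [MeasurableSub₂ G] {μ : Measure G} [SFinite μ] {K f g : G → ℝ≥0∞} (hK : Measurable K)
    (hf : AEMeasurable f μ) (hg : AEMeasurable g μ) :
    AEMeasurable (fun x => ∫⁻ y, K (x - y) * f y * g y ∂μ) μ := by
  refine AEMeasurable.lintegral_prod_right'
    (f := fun z : G × G => K (z.1 - z.2) * f z.2 * g z.2) ?_
  refine ((hK.comp (measurable_fst.sub measurable_snd)).aemeasurable.mul ?_).mul ?_
  · exact hf.comp_quasiMeasurePreserving Measure.quasiMeasurePreserving_snd
  · exact hg.comp_quasiMeasurePreserving Measure.quasiMeasurePreserving_snd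

section Space
variable {E : Type*} [NormedAddCommGroup E] [NormedSpace ℝ E] [FiniteDimensional ℝ E]
  [Nontrivial E] [MeasurableSpace E] [BorelSpace E] (μ : Measure E) [μ.IsAddHaarMeasure]

/-- For a suitable radius, depending only on the bounds `A₁` and `A₂`, the near and the far part of
the kernel `‖z‖^(-a)`, paired with `f` in dual exponents, are controlled by the product of powers of
`A₁` and `A₂` that scaling dictates. -/
theorem exists_truncatedKernel_bound {a : ℝ} {p₁ p₂ : ℝ≥0∞} (hp₁ : 1 ≤ p₁) (hp₁₂ : p₁ < p₂)
    {w w₁ w₂ : ℝ} (ha : a = Module.finrank ℝ E * (1 - w))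
    (h2 : (p₂⁻¹).toReal < w₂) (h2w : w₂ < w) (hw1 : w < w₁) (h1 : w₁ ≤ (p₁⁻¹).toReal)
    (hw₁ : w₁ < 1) :
    ∃ C : ℝ≥0∞, C ≠ ∞ ∧ ∀ (f : E → ℝ) (A₁ A₂ : ℝ≥0∞), AEStronglyMeasurable f μ →
      A₁ ≠ 0 → A₁ ≠ ∞ → A₂ ≠ 0 → A₂ ≠ ∞ → eLpNorm f p₁ μ ≤ A₁ → eLpNorm f p₂ μ ≤ A₂ →
      ∃ R : ℝ,
        (∫⁻ z : E, truncatedKernel a (Set.Iio 1) R z ^ (1 - w₂)⁻¹ ∂μ) ^ (1 / (1 - w₂)⁻¹) *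
            (∫⁻ y, ‖f y‖ₑ ^ w₂⁻¹ ∂μ) ^ (1 / w₂⁻¹) +
          (∫⁻ z : E, truncatedKernel a (Set.Ici 1) R z ^ (1 - w₁)⁻¹ ∂μ) ^ (1 / (1 - w₁)⁻¹) *
            (∫⁻ y, ‖f y‖ₑ ^ w₁⁻¹ ∂μ) ^ (1 / w₁⁻¹) ≤
        C * (A₁ ^ ((w - (p₂⁻¹).toReal) / ((p₁⁻¹).toReal - (p₂⁻¹).toReal)) *
          A₂ ^ (((p₁⁻¹).toReal - w) / ((p₁⁻¹).toReal - (p₂⁻¹).toReal))) := by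
  have hn : 0 < (Module.finrank ℝ E : ℝ) := Nat.cast_pos.2 Module.finrank_pos
  set n : ℝ := (Module.finrank ℝ E : ℝ) with hndef
  set v₁ := (p₁⁻¹).toReal with hv₁
  set v₂ := (p₂⁻¹).toReal with hv₂
  have hv₂0 : 0 ≤ v₂ := ENNReal.toReal_nonneg
  have hD : 0 < v₁ - v₂ := by linarith
  have hnear := lintegral_ball_norm_rpow_lt_top μ (b := a * (1 - w₂)⁻¹) (by
    rw [← div_eq_mul_inv, div_lt_iff₀ (by linarith), ha]
    exact mul_lt_mul_of_pos_left (by linarith) hn)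
  have hfar := lintegral_compl_ball_norm_rpow_lt_top μ (b := a * (1 - w₁)⁻¹) (by
    rw [← div_eq_mul_inv, lt_div_iff₀ (by linarith), ha]
    exact mul_lt_mul_of_pos_left (by linarith) hn)
  have e1 : Metric.ball (0 : E) 1 = {z : E | ‖z‖ ∈ Set.Iio 1} := by ext; simp
  have e2 : (Metric.ball (0 : E) 1)ᶜ = {z : E | ‖z‖ ∈ Set.Ici 1} := by ext; simp
  rw [e1] at hnear
  rw [e2] at hfar
  set c₂ := ∫⁻ z in {z : E | ‖z‖ ∈ Set.Iio 1}, ENNReal.ofReal (‖z‖ ^ (-(a * (1 - w₂)⁻¹))) ∂μ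
  set c₁ := ∫⁻ z in {z : E | ‖z‖ ∈ Set.Ici 1}, ENNReal.ofReal (‖z‖ ^ (-(a * (1 - w₁)⁻¹))) ∂μ
  have hi₁ : 0 < (1 - w₁)⁻¹ := inv_pos.2 (by linarith)
  have hi₂ : 0 < (1 - w₂)⁻¹ := inv_pos.2 (by linarith)
  refine ⟨c₂ ^ (1 / (1 - w₂)⁻¹) + c₁ ^ (1 / (1 - w₁)⁻¹), ?_, ?_⟩
  · exact ENNReal.add_ne_top.2 ⟨ENNReal.rpow_ne_top_of_nonneg (by positivity) hnear.ne,
      ENNReal.rpow_ne_top_of_nonneg (by positivity) hfar.ne⟩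
  intro f A₁ A₂ hf hA₁ hA₁t hA₂ hA₂t hfA₁ hfA₂
  have hx : 0 < A₁.toReal := ENNReal.toReal_pos hA₁ hA₁t
  have hy : 0 < A₂.toReal := ENNReal.toReal_pos hA₂ hA₂t
  set R : ℝ := (A₁.toReal / A₂.toReal) ^ (1 / (n * (v₁ - v₂)))
  have hR : 0 < R := by positivity
  -- At this radius the near and the far part obey the same bound, whatever the exponent `w'`.
  have key {w' : ℝ} (hw'2 : v₂ < w') (hw'1 : w' ≤ v₁) :
      ENNReal.ofReal (R ^ (n * (w - w'))) * (∫⁻ y, ‖f y‖ₑ ^ w'⁻¹ ∂μ) ^ (1 / w'⁻¹) ≤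
        A₁ ^ ((w - v₂) / (v₁ - v₂)) * A₂ ^ ((v₁ - w) / (v₁ - v₂)) := by
    have hint := lintegral_enorm_rpow_interpolate hf hp₁ hp₁₂ (q := w'⁻¹)
      (by rw [one_div, inv_inv]; exact hw'1) (by rw [one_div, inv_inv]; exact hw'2)
    have hw'e : 1 / w'⁻¹ = w' := by simp
    rw [hw'e] at hint ⊢
    have hA {b c : ℝ} : A₁ ^ b * A₂ ^ c = ENNReal.ofReal (A₁.toReal ^ b * A₂.toReal ^ c) := by
      rw [ENNReal.ofReal_mul (by positivity), ← ENNReal.ofReal_rpow_of_pos hx,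
        ← ENNReal.ofReal_rpow_of_pos hy, ENNReal.ofReal_toReal hA₁t, ENNReal.ofReal_toReal hA₂t]
    calc _ ≤ ENNReal.ofReal (R ^ (n * (w - w'))) *
          (A₁ ^ ((w' - v₂) / (v₁ - v₂)) * A₂ ^ ((v₁ - w') / (v₁ - v₂))) := by
          refine mul_le_mul_right (hint.trans ?_) _
          exact mul_le_mul' (ENNReal.rpow_le_rpow hfA₁ (div_nonneg (by linarith) hD.le))
            (ENNReal.rpow_le_rpow hfA₂ (div_nonneg (by linarith) hD.le))
      _ = _ := by
          rw [hA, hA, ← ENNReal.ofReal_mul (by positivity),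
            balancing_radius_rpow hx hy hn.ne' hD.ne']
  refine ⟨R, ?_⟩
  rw [lintegral_truncatedKernel_rpow μ a measurableSet_Iio hR hi₂,
    lintegral_truncatedKernel_rpow μ a measurableSet_Ici hR hi₁, ← hndef]
  have hexp (w' : ℝ) : n * (1 / (1 - w')⁻¹) - a = n * (w - w') := by
    rw [ha, one_div, inv_inv]; ring
  rw [hexp, hexp, add_mul]
  refine add_le_add ?_ ?_
  · rw [mul_comm (ENNReal.ofReal _), mul_assoc]
    exact mul_le_mul_right (key h2 (by linarith)) _
  · rw [mul_comm (ENNReal.ofReal _), mul_assoc]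
    exact mul_le_mul_right (key (by linarith) h1) _

/-- The uniform bound for `|z|^(-a) ∗ |f|` and the `L^s` bound for `|z|^(-a) ∗ (|f| g)`. -/
theorem exists_rieszKernel_bound {a : ℝ} {p₁ p₂ : ℝ≥0∞} (hp₁ : 1 ≤ p₁) (hp₁₂ : p₁ < p₂)
    {w s : ℝ} (hs : 1 ≤ s) (ha : a = Module.finrank ℝ E * (1 - w))
    (h2 : (p₂⁻¹).toReal < w) (h1 : w < (p₁⁻¹).toReal) (hsw : 1 / s + w < 1) :
    ∃ C : ℝ≥0∞, C ≠ ∞ ∧ ∀ (f : E → ℝ) (A₁ A₂ : ℝ≥0∞), AEStronglyMeasurable f μ →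
      A₁ ≠ ∞ → A₂ ≠ ∞ → eLpNorm f p₁ μ ≤ A₁ → eLpNorm f p₂ μ ≤ A₂ →
      (∀ x, ∫⁻ y, rieszKernel a (x - y) * ‖f y‖ₑ ∂μ ≤
        C * (A₁ ^ ((w - (p₂⁻¹).toReal) / ((p₁⁻¹).toReal - (p₂⁻¹).toReal)) *
          A₂ ^ (((p₁⁻¹).toReal - w) / ((p₁⁻¹).toReal - (p₂⁻¹).toReal)))) ∧
      ∀ g : E → ℝ≥0∞, AEMeasurable g μ →
        (∫⁻ x, (∫⁻ y, rieszKernel a (x - y) * ‖f y‖ₑ * g y ∂μ) ^ s ∂μ) ^ (1 / s) ≤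
        C * (A₁ ^ ((w - (p₂⁻¹).toReal) / ((p₁⁻¹).toReal - (p₂⁻¹).toReal)) *
          A₂ ^ (((p₁⁻¹).toReal - w) / ((p₁⁻¹).toReal - (p₂⁻¹).toReal))) *
          (∫⁻ y, g y ^ s ∂μ) ^ (1 / s) := by
  have hs0 : 0 < s := by linarith
  have hv₂0 : 0 ≤ (p₂⁻¹).toReal := ENNReal.toReal_nonneg
  -- Keeping `w₁` below `1 - 1 / s` is what permits the Young type inequality, even if `p₁ = 1`.
  obtain ⟨w₂, hw₂, hw₂'⟩ := exists_between h2
  obtain ⟨w₁, hw₁, hw₁'⟩ := exists_between (lt_min h1 (lt_sub_iff_add_lt'.2 hsw))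
  have hw₁s : w₁ < 1 - 1 / s := hw₁'.trans_le (min_le_right _ _)
  have hs1 : 0 < 1 / s := by positivity
  obtain ⟨C, hC, H⟩ := exists_truncatedKernel_bound μ hp₁ hp₁₂ ha hw₂ hw₂' hw₁
    (hw₁'.le.trans (min_le_left _ _)) (by linarith)
  refine ⟨C, hC, fun f A₁ A₂ hf hA₁t hA₂t hfA₁ hfA₂ => ?_⟩
  -- If `A₁` or `A₂` vanishes there is no balancing radius, but then `f = 0` almost everywhere.
  by_cases hA : A₁ = 0 ∨ A₂ = 0
  · have hf0 : f =ᵐ[μ] 0 := by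
      rcases hA with h | h
      · exact (eLpNorm_eq_zero_iff hf (zero_lt_one.trans_le hp₁).ne').1 (by simpa [h] using hfA₁)
      · exact (eLpNorm_eq_zero_iff hf (zero_le.trans_lt hp₁₂).ne').1 (by simpa [h] using hfA₂)
    refine ⟨fun x => ?_, fun g hg => ?_⟩
    · rw [lintegral_congr_ae (g := 0) (by filter_upwards [hf0] with y hy; simp [hy])]
      simp
    · have h0 (x : E) : ∫⁻ y, rieszKernel a (x - y) * ‖f y‖ₑ * g y ∂μ = 0 := by
        rw [lintegral_congr_ae (g := 0) (by filter_upwards [hf0] with y hy; simp [hy])]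
        simp
      simp [h0, hs0]
  push Not at hA
  obtain ⟨R, hR⟩ := H f A₁ A₂ hf hA.1 hA₁t hA.2 hA₂t hfA₁ hfA₂
  have hconj {w' : ℝ} (h0 : 0 < w') (h1 : w' < 1) : (w'⁻¹).HolderConjugate (1 - w')⁻¹ := by
    rw [Real.holderConjugate_iff]
    exact ⟨(one_lt_inv₀ h0).2 h1, by simp⟩
  have hc₁ := hconj (w' := w₁) (by linarith) (by linarith)
  have hc₂ := hconj (w' := w₂) (by linarith) (by linarith)
  have hK₁ := measurable_truncatedKernel (E := E) a measurableSet_Ici (S := Set.Ici 1) R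
  have hK₂ := measurable_truncatedKernel (E := E) a measurableSet_Iio (S := Set.Iio 1) R
  refine ⟨fun x => ?_, fun g hg => ?_⟩
  · refine le_trans ?_ hR
    have hsplit (x : E) := lintegral_add_left' (μ := μ)
      ((hK₂.comp (measurable_id.const_sub x)).aemeasurable.mul hf.enorm)
      (fun y => truncatedKernel a (Set.Ici 1) R (x - y) * ‖f y‖ₑ)
    simp only [Pi.mul_apply, Function.comp_apply, id] at hsplit
    simp_rw [rieszKernel_eq_add a R, add_mul, hsplit]
    exact add_le_add (lintegral_kernel_mul_le hK₂ hf.enorm hc₂ x)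
      (lintegral_kernel_mul_le hK₁ hf.enorm hc₁ x)
  · refine le_trans ?_ (mul_le_mul_left hR _)
    simp_rw [rieszKernel_eq_add a R, add_mul]
    have hsplit (x : E) := lintegral_add_left' (μ := μ)
      (((hK₂.comp (measurable_id.const_sub x)).aemeasurable.mul hf.enorm).mul hg)
      (fun y => truncatedKernel a (Set.Ici 1) R (x - y) * ‖f y‖ₑ * g y)
    simp only [Pi.mul_apply, Function.comp_apply, id] at hsplit
    simp_rw [hsplit]
    refine (ENNReal.lintegral_Lp_add_le (aemeasurable_lintegral_kernel_mul_mul hK₂ hf.enorm hg)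
      (aemeasurable_lintegral_kernel_mul_mul hK₁ hf.enorm hg) hs).trans ?_
    refine add_le_add (lintegral_kernel_mul_mul_rpow_le hK₂ hf.enorm hg hc₂ hs0 ?_)
      (lintegral_kernel_mul_mul_rpow_le hK₁ hf.enorm hg hc₁ hs0 ?_)
    · rw [one_div w₂⁻¹, inv_inv]; linarith
    · rw [one_div w₁⁻¹, inv_inv]; linarith
end Space

/-! ### Measurability and slices of products -/

theorem ae_prod_lt_top {α β : Type*} [MeasurableSpace α] [MeasurableSpace β] {μ : Measure α}
    {ν : Measure β} [SFinite ν] {f : α × β → ℝ≥0∞} (hf : AEMeasurable f (μ.prod ν))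
    (h : ∀ᵐ a ∂μ, ∀ᵐ b ∂ν, f (a, b) < ∞) : ∀ᵐ z ∂μ.prod ν, f z < ∞ := by
  have hmk : ∀ᵐ z ∂μ.prod ν, hf.mk f z < ∞ := by
    refine (Measure.ae_prod_iff_ae_ae (measurableSet_lt hf.measurable_mk measurable_const)).2 ?_
    filter_upwards [h, Measure.ae_ae_of_ae_prod hf.ae_eq_mk] with a h₁ h₂
    filter_upwards [h₁, h₂] with b h₁ h₂
    rwa [← h₂]
  filter_upwards [hmk, hf.ae_eq_mk] with z h₁ h₂
  rwa [h₂]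

theorem aestronglyMeasurable_fst_fst_snd {α β F : Type*} [MeasurableSpace α] [MeasurableSpace β]
    [TopologicalSpace F] {μ : Measure α} {ν : Measure β} [SFinite μ] [SFinite ν]
    {f : α → β → F} (hf : AEStronglyMeasurable (Function.uncurry f) (μ.prod ν)) :
    AEStronglyMeasurable (fun w : (α × β) × β => f w.1.1 w.2) ((μ.prod ν).prod ν) :=
  hf.comp_quasiMeasurePreserving
    (MeasureTheory.QuasiMeasurePreserving.prodMap Measure.quasiMeasurePreserving_fst
      (Measure.QuasiMeasurePreserving.id ν))

theorem eLpNorm_ofReal_eq {α F : Type*} [MeasurableSpace α] [NormedAddCommGroup F]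
    {μ : Measure α} {s : ℝ} (hs : 0 < s) (f : α → F) :
    eLpNorm f (ENNReal.ofReal s) μ = (∫⁻ x, ‖f x‖ₑ ^ s ∂μ) ^ (1 / s) := by
  rw [eLpNorm_eq_lintegral_rpow_enorm_toReal (by simpa using hs) ENNReal.ofReal_ne_top,
    ENNReal.toReal_ofReal hs.le]

/-! ### Riesz potentials and commutators -/

section Commutator
variable {N : ℕ} {F : Type*} [NormedAddCommGroup F] [NormedSpace ℝ F]

theorem enorm_rieszIntegrand (a : ℝ) (f : EuclideanSpace ℝ (Fin N) → F)
    (x y : EuclideanSpace ℝ (Fin N)) :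
    ‖rieszIntegrand ((N : ℝ) - a) f x y‖ₑ = rieszKernel a (x - y) * ‖f y‖ₑ := by
  rw [rieszIntegrand, enorm_smul, rieszKernel, sub_sub_cancel, Real.rpow_neg (norm_nonneg _),
    one_div, Real.enorm_of_nonneg (by positivity)]

theorem aestronglyMeasurable_rieszIntegrand {α : ℝ} {μ : Measure ℝ} [SFinite μ]
    {f : ℝ → EuclideanSpace ℝ (Fin N) → F}
    (hf : AEStronglyMeasurable (Function.uncurry f) (μ.prod volume)) :
    AEStronglyMeasurable (fun w : (ℝ × EuclideanSpace ℝ (Fin N)) × EuclideanSpace ℝ (Fin N) =>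
      rieszIntegrand α (f w.1.1) w.1.2 w.2) ((μ.prod volume).prod volume) := by
  unfold rieszIntegrand
  refine AEStronglyMeasurable.smul ?_ (aestronglyMeasurable_fst_fst_snd hf)
  have : Measurable fun w : (ℝ × EuclideanSpace ℝ (Fin N)) × EuclideanSpace ℝ (Fin N) =>
      1 / ‖w.1.2 - w.2‖ ^ ((N : ℝ) - α) := by fun_prop
  exact this.aestronglyMeasurable

/-- Absolute convergence at almost every `(t, x)`, from its validity for almost every `x` on almost
every time slice. -/
theorem ae_integrable_rieszIntegrand {a : ℝ} {μ : Measure ℝ} [SFinite μ]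
    {f : ℝ → EuclideanSpace ℝ (Fin N) → F}
    (hf : AEStronglyMeasurable (Function.uncurry f) (μ.prod volume))
    (h : ∀ᵐ t ∂μ, ∀ᵐ x, ∫⁻ y, rieszKernel a (x - y) * ‖f t y‖ₑ < ∞) :
    ∀ᵐ z ∂μ.prod volume, Integrable (rieszIntegrand ((N : ℝ) - a) (f z.1) z.2) := by
  have hm := aestronglyMeasurable_rieszIntegrand (α := (N : ℝ) - a) hf
  have hfin := ae_prod_lt_top (f := fun z => ∫⁻ y, ‖rieszIntegrand ((N : ℝ) - a) (f z.1) z.2 y‖ₑ)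
    hm.enorm.lintegral_prod_right' (by simpa only [enorm_rieszIntegrand] using h)
  filter_upwards [hm.prodMk_left, hfin] with z h₁ h₂
  exact ⟨h₁, h₂⟩

theorem aestronglyMeasurable_rieszCommutator {α : ℝ} {μ : Measure ℝ} [SFinite μ]
    {ρ : ℝ → EuclideanSpace ℝ (Fin N) → ℝ} {u : ℝ → EuclideanSpace ℝ (Fin N) → F}
    (hρ : AEStronglyMeasurable (Function.uncurry ρ) (μ.prod volume))
    (hu : AEStronglyMeasurable (Function.uncurry u) (μ.prod volume)) :
    AEStronglyMeasurable (Function.uncurry fun t => rieszCommutator α (u t) (ρ t))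
      (μ.prod volume) := by
  have hρu : AEStronglyMeasurable (Function.uncurry fun t y => ρ t y • u t y) (μ.prod volume) :=
    hρ.smul hu
  exact ((aestronglyMeasurable_rieszIntegrand hρ).integral_prod_right'.smul hu).sub
    (aestronglyMeasurable_rieszIntegrand hρu).integral_prod_right'

theorem enorm_rieszCommutator_le (a : ℝ) (u : EuclideanSpace ℝ (Fin N) → F)
    (ρ : EuclideanSpace ℝ (Fin N) → ℝ) (x : EuclideanSpace ℝ (Fin N)) :
    ‖rieszCommutator ((N : ℝ) - a) u ρ x‖ₑ ≤
      (∫⁻ y, rieszKernel a (x - y) * ‖ρ y‖ₑ) * ‖u x‖ₑ +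
        ∫⁻ y, rieszKernel a (x - y) * ‖ρ y‖ₑ * ‖u y‖ₑ := by
  rw [rieszCommutator]
  refine enorm_sub_le.trans (add_le_add ?_ ?_)
  · rw [enorm_smul]
    gcongr
    refine (enorm_integral_le_lintegral_enorm _).trans_eq ?_
    simp only [enorm_rieszIntegrand]
  · refine (enorm_integral_le_lintegral_enorm _).trans_eq ?_
    simp only [enorm_rieszIntegrand, enorm_smul, mul_assoc]

theorem eLpNorm_rieszCommutator_le {a s : ℝ} (hs : 1 ≤ s) {B : ℝ≥0∞}
    {u : EuclideanSpace ℝ (Fin N) → F} {ρ : EuclideanSpace ℝ (Fin N) → ℝ}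
    (hρ : AEStronglyMeasurable ρ) (hu : AEStronglyMeasurable u)
    (hB : ∀ x, ∫⁻ y, rieszKernel a (x - y) * ‖ρ y‖ₑ ≤ B)
    (hBs : (∫⁻ x, (∫⁻ y, rieszKernel a (x - y) * ‖ρ y‖ₑ * ‖u y‖ₑ) ^ s) ^ (1 / s) ≤
      B * (∫⁻ y, ‖u y‖ₑ ^ s) ^ (1 / s)) :
    eLpNorm (rieszCommutator ((N : ℝ) - a) u ρ) (ENNReal.ofReal s) volume ≤
      2 * B * eLpNorm u (ENNReal.ofReal s) volume := by
  have hs0 : 0 < s := by linarith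
  rw [eLpNorm_ofReal_eq hs0, eLpNorm_ofReal_eq hs0]
  have hJ := aemeasurable_lintegral_kernel_mul_mul (measurable_rieszKernel (E := _) a) hρ.enorm
    hu.enorm
  calc _ ≤ (∫⁻ x, (B * ‖u x‖ₑ + ∫⁻ y, rieszKernel a (x - y) * ‖ρ y‖ₑ * ‖u y‖ₑ) ^ s) ^ (1 / s) := by
        gcongr with x
        exact (enorm_rieszCommutator_le a u ρ x).trans (by gcongr; exact hB x)
    _ ≤ (∫⁻ x, (B * ‖u x‖ₑ) ^ s) ^ (1 / s) +
          (∫⁻ x, (∫⁻ y, rieszKernel a (x - y) * ‖ρ y‖ₑ * ‖u y‖ₑ) ^ s) ^ (1 / s) :=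
        ENNReal.lintegral_Lp_add_le (hu.enorm.const_mul B) hJ hs
    _ ≤ B * (∫⁻ x, ‖u x‖ₑ ^ s) ^ (1 / s) + B * (∫⁻ x, ‖u x‖ₑ ^ s) ^ (1 / s) := by
        refine add_le_add (le_of_eq ?_) hBs
        simp_rw [ENNReal.mul_rpow_of_nonneg _ _ hs0.le]
        rw [lintegral_const_mul'' _ (hu.enorm.pow_const s),
          ENNReal.mul_rpow_of_nonneg _ _ (by positivity), ← ENNReal.rpow_mul,
          mul_one_div_cancel hs0.ne', ENNReal.rpow_one]
    _ = _ := by ring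
end Commutator

/-! ### Mixed norms in time and space -/

instance sigmaFinite_timeMeasure (T : EReal) : SigmaFinite (timeMeasure T) := by
  unfold timeMeasure; infer_instance

theorem ae_eLpNorm_le_mixedNorm_top {N : ℕ} {F : Type*} [NormedAddCommGroup F] (T : EReal)
    (p : ℝ≥0∞) (f : ℝ → EuclideanSpace ℝ (Fin N) → F) :
    ∀ᵐ t ∂timeMeasure T, eLpNorm (f t) p volume ≤ mixedNorm T ∞ p f := by
  rw [mixedNorm, eLpNorm_exponent_top]
  filter_upwards [ae_le_eLpNormEssSup (f := fun t => eLpNorm (f t) p volume)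
    (μ := timeMeasure T)] with t ht
  simpa using ht

theorem mixedNorm_one {N : ℕ} {F : Type*} [NormedAddCommGroup F] (T : EReal)
    (p : ℝ≥0∞) (f : ℝ → EuclideanSpace ℝ (Fin N) → F) :
    mixedNorm T 1 p f = ∫⁻ t, eLpNorm (f t) p volume ∂timeMeasure T := by
  simp [mixedNorm, eLpNorm_one_eq_lintegral_enorm]

theorem theorem4p3 (N : ℕ) (hN : 1 ≤ N) (lam : ℝ) (p₁ p₂ : ℝ≥0∞) (s : ℝ)
    (hp₁ : 1 ≤ p₁) (hp₁₂ : p₁ < p₂) (hs : 1 ≤ s)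
    (h₂ : (p₂⁻¹).toReal < 1 - 2 * lam / N)
    (h₁ : 1 - 2 * lam / N < (p₁⁻¹).toReal)
    (hslam : (N : ℝ) / (2 * lam) < s) :
    ∃ C : ℝ, 0 < C ∧
      ∀ (m : ℕ) (T : EReal), 0 < T →
      ∀ (ρ : ℝ → EuclideanSpace ℝ (Fin N) → ℝ)
        (u : ℝ → EuclideanSpace ℝ (Fin N) → EuclideanSpace ℝ (Fin m)),
        MemMixed T ∞ p₁ ρ → MemMixed T ∞ p₂ ρ → MemMixed T 1 (ENNReal.ofReal s) u →
        (∀ᵐ z : ℝ × EuclideanSpace ℝ (Fin N) ∂((timeMeasure T).prod volume),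
          Integrable (rieszIntegrand ((N : ℝ) - 2 * lam) (ρ z.1) z.2) ∧
          Integrable (rieszIntegrand ((N : ℝ) - 2 * lam)
            (fun y => ρ z.1 y • u z.1 y) z.2)) ∧
        MemMixed T 1 (ENNReal.ofReal s)
          (fun t => rieszCommutator ((N : ℝ) - 2 * lam) (u t) (ρ t)) ∧
        mixedNorm T 1 (ENNReal.ofReal s)
            (fun t => rieszCommutator ((N : ℝ) - 2 * lam) (u t) (ρ t)) ≤
          ENNReal.ofReal C * mixedNorm T 1 (ENNReal.ofReal s) u *
            mixedNorm T ∞ p₁ ρ ^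
              ((1 - (p₂⁻¹).toReal - 2 * lam / N) / ((p₁⁻¹).toReal - (p₂⁻¹).toReal)) *
            mixedNorm T ∞ p₂ ρ ^
              ((2 * lam / N - (1 - (p₁⁻¹).toReal)) / ((p₁⁻¹).toReal - (p₂⁻¹).toReal)) := by
  have hN0 : (0 : ℝ) < N := by exact_mod_cast hN
  have hs0 : 0 < s := by linarith
  have : NeZero N := ⟨by omega⟩
  have hp₁1 : (p₁⁻¹).toReal ≤ 1 := by
    simpa using ENNReal.toReal_mono ENNReal.one_ne_top (ENNReal.inv_le_one.2 hp₁)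
  have hlam : 0 < 2 * lam := by
    have : 0 < 2 * lam / N := by linarith
    simpa [hN0] using (div_pos_iff_of_pos_right hN0).1 this
  have hsw : 1 / s + (1 - 2 * lam / N) < 1 := by
    have : 1 / s < 2 * lam / N := by
      rw [div_lt_div_iff₀ hs0 hN0, one_mul]
      rwa [div_lt_iff₀ hlam, mul_comm] at hslam
    linarith
  have ha : 2 * lam = Module.finrank ℝ (EuclideanSpace ℝ (Fin N)) * (1 - (1 - 2 * lam / N)) := by
    rw [finrank_euclideanSpace_fin]; field_simp; ring
  obtain ⟨C, hC, H⟩ := exists_rieszKernel_bound (E := EuclideanSpace ℝ (Fin N)) volume hp₁ hp₁₂ hs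
    ha h₂ h₁ hsw
  rw [show (1 : ℝ) - (p₂⁻¹).toReal - 2 * lam / N = 1 - 2 * lam / N - (p₂⁻¹).toReal by ring,
    show 2 * lam / N - (1 - (p₁⁻¹).toReal) = (p₁⁻¹).toReal - (1 - 2 * lam / N) by ring]
  set e₁ := (1 - 2 * lam / N - (p₂⁻¹).toReal) / ((p₁⁻¹).toReal - (p₂⁻¹).toReal)
  set e₂ := ((p₁⁻¹).toReal - (1 - 2 * lam / N)) / ((p₁⁻¹).toReal - (p₂⁻¹).toReal)
  have he₁ : 0 ≤ e₁ := div_nonneg (by linarith) (by linarith)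
  have he₂ : 0 ≤ e₂ := div_nonneg (by linarith) (by linarith)
  -- The summand `1` only makes the constant positive.
  refine ⟨2 * C.toReal + 1, by positivity, fun m T _ ρ u hρ₁ hρ₂ hu => ?_⟩
  set A₁ := mixedNorm T ∞ p₁ ρ
  set A₂ := mixedNorm T ∞ p₂ ρ
  set B := C * (A₁ ^ e₁ * A₂ ^ e₂) with hBdef
  have hB : B ≠ ∞ := ENNReal.mul_ne_top hC (ENNReal.mul_ne_top
    (ENNReal.rpow_ne_top_of_nonneg he₁ hρ₁.2.ne) (ENNReal.rpow_ne_top_of_nonneg he₂ hρ₂.2.ne))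
  have hslice : ∀ᵐ t ∂timeMeasure T, AEStronglyMeasurable (u t) ∧ AEStronglyMeasurable (ρ t) ∧
      (∀ x, ∫⁻ y, rieszKernel (2 * lam) (x - y) * ‖ρ t y‖ₑ ≤ B) ∧
      (∫⁻ x, (∫⁻ y, rieszKernel (2 * lam) (x - y) * ‖ρ t y‖ₑ * ‖u t y‖ₑ) ^ s) ^ (1 / s) ≤
        B * (∫⁻ y, ‖u t y‖ₑ ^ s) ^ (1 / s) := by
    filter_upwards [hρ₁.1.prodMk_left, hu.1.prodMk_left, ae_eLpNorm_le_mixedNorm_top T p₁ ρ,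
      ae_eLpNorm_le_mixedNorm_top T p₂ ρ] with t hρt hut ht₁ ht₂
    obtain ⟨h, h'⟩ := H (ρ t) A₁ A₂ hρt hρ₁.2.ne hρ₂.2.ne ht₁ ht₂
    exact ⟨hut, hρt, h, h' (fun y => ‖u t y‖ₑ) hut.enorm⟩
  have hunorm : ∀ᵐ t ∂timeMeasure T, (∫⁻ y, ‖u t y‖ₑ ^ s) ^ (1 / s) < ∞ := by
    refine ae_lt_top' ?_ ?_
    · exact (hu.1.enorm.pow_const s).lintegral_prod_right'.pow_const _
    · have := hu.2.ne
      rw [mixedNorm_one] at this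
      simpa only [eLpNorm_ofReal_eq hs0] using this
  have hbound : mixedNorm T 1 (ENNReal.ofReal s)
      (fun t => rieszCommutator ((N : ℝ) - 2 * lam) (u t) (ρ t)) ≤
        2 * B * mixedNorm T 1 (ENNReal.ofReal s) u := by
    rw [mixedNorm_one, mixedNorm_one,
      ← lintegral_const_mul' _ _ (ENNReal.mul_ne_top ENNReal.ofNat_ne_top hB)]
    refine lintegral_mono_ae ?_
    filter_upwards [hslice] with t ⟨hut, hρt, h, h'⟩
    exact eLpNorm_rieszCommutator_le hs hρt hut h h'
  refine ⟨?_, ⟨aestronglyMeasurable_rieszCommutator hρ₁.1 hu.1, hbound.trans_lt ?_⟩,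
    hbound.trans ?_⟩
  · refine (ae_integrable_rieszIntegrand hρ₁.1 ?_).and
      (ae_integrable_rieszIntegrand (f := fun t y => ρ t y • u t y) (hρ₁.1.smul hu.1) ?_)
    · filter_upwards [hslice] with t ⟨_, _, h, _⟩
      exact ae_of_all _ fun x => (h x).trans_lt hB.lt_top
    · filter_upwards [hslice, hunorm] with t ⟨hut, hρt, _, h⟩ hfin
      have hJ := aemeasurable_lintegral_kernel_mul_mul (measurable_rieszKernel (2 * lam)) hρt.enorm
        hut.enorm
      have hlt := h.trans_lt (ENNReal.mul_lt_top hB.lt_top hfin)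
      rw [ENNReal.rpow_lt_top_iff_of_pos (by positivity)] at hlt
      filter_upwards [ae_lt_top' (hJ.pow_const s) hlt.ne] with x hx
      rw [ENNReal.rpow_lt_top_iff_of_pos hs0] at hx
      simpa only [enorm_smul, mul_assoc] using hx
  · exact ENNReal.mul_lt_top (ENNReal.mul_lt_top ENNReal.ofNat_lt_top hB.lt_top) hu.2
  · have hC2 : 2 * C ≤ ENNReal.ofReal (2 * C.toReal + 1) := by
      rw [ENNReal.ofReal_add (by positivity) zero_le_one, ENNReal.ofReal_mul zero_le_two,
        ENNReal.ofReal_toReal hC]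
      simp
    calc _ = 2 * C * (mixedNorm T 1 (ENNReal.ofReal s) u * A₁ ^ e₁ * A₂ ^ e₂) := by
          rw [hBdef]; ring
      _ ≤ ENNReal.ofReal (2 * C.toReal + 1) *
            (mixedNorm T 1 (ENNReal.ofReal s) u * A₁ ^ e₁ * A₂ ^ e₂) := by gcongr
      _ = _ := by ring
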